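/- Consider a periodic-review, single-product inventory system with constant lead time $\tau\in\{0,1,2,\dots\}$, unit sale price $r\ge 0$, unit holding cost $h\ge 0$ per period, and retention probability $p\in[0,1]$. The demands $D_1,D_2,\dots$ are i.i.d. nonnegative-integer-valued random variables with finite mean. For each period $i$, $\xi_{i;1},\xi_{i;2},\dots$ are i.i.d. Bernoulli random variables with mean $p$; the sequences $(\xi_{i;\ell})_{\ell\ge1}$, $i\ge 1$, are independent of each other and of the demands. In period $i$ the state is $X_i=(I_i,B_{i-1},Q_{i-\tau},\dots,Q_{i-1})$ (on-hand inventory, backorders, outstanding orders). The order $Q_i$ is placed, the order $Q_{i-\tau}$ is delivered (if $\tau=0$, this is $Q_i$ itself), and $D_i$ is realized. The unmet demand is $U_i=(B_{i-1}+D_i-I_i-Q_{i-\tau})^+$, of which $B_i=\sum_{\ell=1}^{U_i}\xi_{i;\ell}$ is backordered and the rest is lost, and $I_{i+1}=(I_i+Q_{i-\tau}-B_{i-1}-D_i)^+$. This is the $P$-system. The $B$-system, whose quantities carry a bar, has the same demands and the same dynamics except that all unmet demand is backordered: $\overline B_i=\overline U_i$. The inventory position is $IP_i=I_i+\sum_{j=i-\tau}^{i-1}Q_j-B_{i-1}$.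 The base-stock policy with level $s\in\mathbb Z$ orders $Q_i=(s-IP_i)^+$ in each period; quantities under it carry the superscript $s$. The overshoot in the $P$-system is $O_i^s=(IP_i^s-s)^+$. For a deterministic initial state $X_1=\mathbf x$, define the (extended real-valued) long-run average profits $$\mathcal C^s(r,h;\mathbf x)=\liminf_{N\to\infty}\frac1N\,\mathbb E\sum_{i=1}^N \Pi(I_i^s,B_{i-1}^s,Q_{i-\tau}^s),\qquad \overline{\mathcal C}^s(r,h,b;\mathbf x)=\liminf_{N\to\infty}\frac1N\,\mathbb E\sum_{i=1}^N \overline\Pi_b(\overline I_i^s,\overline B_{i-1}^s,\overline Q_{i-\tau}^s),$$ where $\Pi(I,B,Q)=\mathbb E\big[r\min(I+Q,\,B+D_1)-h(I+Q-B-D_1)^+\big]$ and $\overline\Pi_b(I,B,Q)=\Pi(I,B,Q)-b\,\mathbb E\big[(B+D_1-I-Q)^+\big]$; that is, $b$ is the cost per unit backordered at the end of each period in the $B$-system. Then for every $s\in\mathbb Z$ and every initial state $\mathbf x=(I_1,B_0,Q_{1-\tau},\dots,Q_0)$ of nonnegative integers with $I_1B_0=0$, used for both systems, all the expectations $\mathbb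 E\,\Pi(I_i^s,B_{i-1}^s,Q_{i-\tau}^s)$, $\mathbb E\,\overline\Pi_{r+\tau h}(\overline I_i^s,\overline B_{i-1}^s,\overline Q_{i-\tau}^s)$ and $\mathbb E\,O_i^s$ are finite, and $$\mathcal C^{s}(r,h;\mathbf x)\ \ge\ \overline{\mathcal C}^s(r,h,r+\tau h;\mathbf x)-\limsup_{N\to\infty}\frac1N\,h\,\mathbb E\sum_{i=1}^N O_i^s .$$ -/

import Mathlib

open MeasureTheory ProbabilityTheory Filter

namespace PartialBackorder

/-- State at the beginning of a period `i`, for lead time `τ`: on-hand inventory `I_i`, backorders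
`B_{i-1}`, and outstanding orders `(Q_{i-τ}, …, Q_{i-1})`, oldest first (none if `τ = 0`). -/
structure State (τ : ℕ) where
  onHand : ℕ
  backorder : ℕ
  pipeline : Fin τ → ℕ

/-- The state space: all states in which on-hand inventory and backorders are not both positive. -/
def stateSpace (τ : ℕ) : Set (State τ) := {x | x.onHand * x.backorder = 0}

/-- Inventory position `IP_i = I_i + Q_{i-τ} + ⋯ + Q_{i-1} - B_{i-1}` (before ordering). -/
def State.inventoryPosition {τ : ℕ} (x : State τ) : ℤ :=
  (x.onHand : ℤ) + ∑ j, (x.pipeline j : ℤ) - (x.backorder : ℤ)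

/-- The orders `(Q_{i-τ}, …, Q_{i-1}, Q_i)` once the current order `q = Q_i` is placed. -/
def State.orders {τ : ℕ} (x : State τ) (q : ℕ) : Fin (τ + 1) → ℕ :=
  Fin.snoc (α := fun _ => ℕ) x.pipeline q

/-- The order `Q_{i-τ}` delivered in the period; it is the current order `q` when `τ = 0`. -/
def State.arrival {τ : ℕ} (x : State τ) (q : ℕ) : ℕ := x.orders q 0

/-- Unmet demand `U_i = (B_{i-1} + D_i - I_i - Q_{i-τ})⁺` (natural subtraction is truncated). -/
def State.unmet {τ : ℕ} (x : State τ) (q d : ℕ) : ℕ :=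
  (x.backorder + d) - (x.onHand + x.arrival q)

/-- One period: order `q`, demand `d`, and decisions `z` of the unmet customers (`z ℓ = true`: the
customer number `ℓ` keeps waiting; `z ℓ = false`: the customer is lost). -/
def State.next {τ : ℕ} (x : State τ) (q d : ℕ) (z : ℕ → Bool) : State τ where
  onHand := (x.onHand + x.arrival q) - (x.backorder + d)
  backorder := ∑ ℓ ∈ Finset.range (x.unmet q d), (z ℓ).toNat
  pipeline := Fin.tail (x.orders q)

/-- An admissible order policy: the order in each period is a function of the current state. -/
abbrev Policy (τ : ℕ) := ℕ → State τ → ℕ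

/-- The base-stock policy with level `s`: order `(s - IP_i)⁺`. -/
def baseStock (τ : ℕ) (s : ℤ) : Policy τ := fun _ x => (s - x.inventoryPosition).toNat

/-- Sample path from the initial state `x` under the policy `π`, for the demands `d` and the
customers' decisions `z`. Index `n` stands for period `n + 1`. -/
def path {τ : ℕ} (π : Policy τ) (x : State τ) (d : ℕ → ℕ) (z : ℕ → ℕ → Bool) : ℕ → State τ
  | 0 => x
  | n + 1 => (path π x d z n).next (π n (path π x d z n)) (d n) (z n)

/-- Decisions in the fully backordered system: every unmet customer keeps waiting. -/
def allWait : ℕ → ℕ → Bool := fun _ _ => true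

noncomputable section

/-- Realized profit of one period with on-hand inventory `I`, backorders `B`, delivery `Q` and
demand `d`: revenue `r` per unit sold, holding cost `h` per unit left over. -/
def realizedProfit (r h : ℝ) (I B Q d : ℕ) : ℝ :=
  r * min ((I : ℝ) + Q) ((B : ℝ) + d) - h * max ((I : ℝ) + Q - B - d) 0

variable {Ω : Type*} [MeasurableSpace Ω]

/-- The model primitives: i.i.d. `ℕ`-valued demands `D_i` with finite mean, and Bernoulli variables
`ξ_{i;ℓ}` of mean `p`, i.i.d. in `ℓ` for each period `i`, such that the sequences `(ξ_{i;ℓ})_ℓ`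
are independent over `i` and are (jointly) independent of the demands. -/
structure IsModel (μ : Measure Ω) (p : ℝ) (D : ℕ → Ω → ℕ) (ξ : ℕ → ℕ → Ω → Bool) : Prop where
  demand_measurable : ∀ i, Measurable (D i)
  demand_indep : iIndepFun D μ
  demand_identDistrib : ∀ i, IdentDistrib (D i) (D 0) μ μ
  demand_integrable : Integrable (fun ω => (D 0 ω : ℝ)) μ
  patience_measurable : ∀ i ℓ, Measurable (ξ i ℓ)
  patience_bernoulli : ∀ i ℓ, μ {ω | ξ i ℓ ω = true} = ENNReal.ofReal p
  patience_indep : ∀ i, iIndepFun (ξ i) μ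
  patience_indep_periods : iIndepFun (fun i ω => (fun ℓ => ξ i ℓ ω : ℕ → Bool)) μ
  demand_indep_patience :
    IndepFun (fun ω => (fun i => D i ω : ℕ → ℕ)) (fun ω => (fun i ℓ => ξ i ℓ ω : ℕ → ℕ → Bool)) μ

/-- Expected one-period profit of the partial backorder system, given `(I, B, Q)`; the expectation
is with respect to the demand `Di` of the period. -/
def expectedProfit (μ : Measure Ω) (Di : Ω → ℕ) (r h : ℝ) (I B Q : ℕ) : ℝ :=
  ∫ ω, realizedProfit r h I B Q (Di ω) ∂μ

/-- The same when, in addition, each unit backordered at the end of the period (in the fully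
backordered system: each unit of unmet demand) costs `b`. -/
def expectedProfitBackorder (μ : Measure Ω) (Di : Ω → ℕ) (r h b : ℝ) (I B Q : ℕ) : ℝ :=
  ∫ ω, (realizedProfit r h I B Q (Di ω) - b * max ((B : ℝ) + Di ω - I - Q) 0) ∂μ

variable {τ : ℕ}

/-- State process of the partial backorder system (P-system). -/
def stateP (D : ℕ → Ω → ℕ) (ξ : ℕ → ℕ → Ω → Bool) (π : Policy τ) (x : State τ)
    (i : ℕ) (ω : Ω) : State τ :=
  path π x (fun n => D n ω) (fun n ℓ => ξ n ℓ ω) i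

/-- State process of the fully backordered system (B-system). -/
def stateB (D : ℕ → Ω → ℕ) (π : Policy τ) (x : State τ) (i : ℕ) (ω : Ω) : State τ :=
  path π x (fun n => D n ω) allWait i

/-- Expected profit of a period in the P-system, given the state of that period. -/
def profitP (μ : Measure Ω) (D : ℕ → Ω → ℕ) (ξ : ℕ → ℕ → Ω → Bool) (π : Policy τ) (r h : ℝ)
    (x : State τ) (i : ℕ) (ω : Ω) : ℝ :=
  expectedProfit μ (D i) r h (stateP D ξ π x i ω).onHand (stateP D ξ π x i ω).backorder
    ((stateP D ξ π x i ω).arrival (π i (stateP D ξ π x i ω)))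

/-- Expected profit of a period in the B-system with backorder cost `b`, given the state. -/
def profitB (μ : Measure Ω) (D : ℕ → Ω → ℕ) (π : Policy τ) (r h b : ℝ)
    (x : State τ) (i : ℕ) (ω : Ω) : ℝ :=
  expectedProfitBackorder μ (D i) r h b (stateB D π x i ω).onHand (stateB D π x i ω).backorder
    ((stateB D π x i ω).arrival (π i (stateB D π x i ω)))

/-- Overshoot `O_i = (IP_i - s)⁺` of the P-system under the base-stock policy with level `s`. -/
def overshoot (D : ℕ → Ω → ℕ) (ξ : ℕ → ℕ → Ω → Bool) (s : ℤ) (x : State τ)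
    (i : ℕ) (ω : Ω) : ℝ :=
  max (((stateP D ξ (baseStock τ s) x i ω).inventoryPosition : ℝ) - s) 0

/-- Long-run average profit of the P-system, as an extended real number. -/
def avgProfitP (μ : Measure Ω) (D : ℕ → Ω → ℕ) (ξ : ℕ → ℕ → Ω → Bool) (π : Policy τ) (r h : ℝ)
    (x : State τ) : EReal :=
  liminf (fun N : ℕ =>
    (((1 / (N : ℝ)) * ∫ ω, ∑ i ∈ Finset.range N, profitP μ D ξ π r h x i ω ∂μ : ℝ) : EReal)) atTop

/-- Long-run average profit of the B-system with backorder cost `b`. -/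
def avgProfitB (μ : Measure Ω) (D : ℕ → Ω → ℕ) (π : Policy τ) (r h b : ℝ)
    (x : State τ) : EReal :=
  liminf (fun N : ℕ =>
    (((1 / (N : ℝ)) * ∫ ω, ∑ i ∈ Finset.range N, profitB μ D π r h b x i ω ∂μ : ℝ) : EReal)) atTop

/-- Long-run average overshoot cost `limsup (1/N) h E[O_1 + ⋯ + O_N]`. -/
def avgOvershootCost (μ : Measure Ω) (D : ℕ → Ω → ℕ) (ξ : ℕ → ℕ → Ω → Bool) (s : ℤ) (h : ℝ)
    (x : State τ) : EReal :=
  limsup (fun N : ℕ =>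
    (((1 / (N : ℝ)) * (h * ∫ ω, ∑ i ∈ Finset.range N, overshoot D ξ s x i ω ∂μ) : ℝ) : EReal)) atTop

end

end PartialBackorder

/-! Both systems are run on the same demands and compared path by path. For `k ≤ τ`, the partial
position is net inventory plus the `k + 1` oldest orders, the current one included. It shifts from
`k + 1` to `k` each period, loses the demand and gains the lost sales `L`; at `k = τ` base stock
makes it `max IP s`. Since `L` is nonnegative, and zero in the B-system, the P-system has the larger
partial positions (`pathPosition_allWait_le`), hence the smaller unmet demand.

Let `E k` be the excess of the P-position over the B-position. Leftover stock differs by at most `E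
0`, and `E τ` is at most the overshoot. The sum of `E k` over `k < τ` changes in a period by `E τ -
E 0 + τ L`, so extra holding cost is paid by overshoot plus `τ h` per lost unit. Revenue falls by
`r` per lost unit, up to a telescoping backorder term. As `L` is at most the unmet demand of the
B-system, the backorder cost `r + τ h` covers both (`stateProfit_allWait_le`). The potentials vanish
initially and are nonnegative at the end, so the cumulative inequality holds on every path.

The state is independent of the current demand, so expected and realized profits have equal means;
taking expectations and limits finishes the proof. -/

namespace PartialBackorder

/-! ### Partial inventory positions in one period -/

section Dynamics

variable {τ : ℕ}

/-- Net inventory plus the first `k + 1` entries of the pipeline, once the order `q` is placed. -/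
def State.partialPosition (x : State τ) (q k : ℕ) : ℤ :=
  (x.onHand : ℤ) - x.backorder +
    ∑ j ∈ Finset.range (k + 1), if hj : j < τ + 1 then (x.orders q ⟨j, hj⟩ : ℤ) else 0

/-- Total number of units recorded in the state. -/
def State.size (x : State τ) : ℕ := x.onHand + x.backorder + ∑ j, x.pipeline j

theorem State.partialPosition_zero (x : State τ) (q : ℕ) :
    x.partialPosition q 0 = (x.onHand : ℤ) + x.arrival q - x.backorder := by
  have h0 : (⟨0, Nat.succ_pos τ⟩ : Fin (τ + 1)) = 0 := rfl
  simp [State.partialPosition, State.arrival, h0]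
  ring

theorem State.sum_orders (x : State τ) (q : ℕ) :
    ∑ j, x.orders q j = ∑ j, x.pipeline j + q := by
  rw [Fin.sum_univ_castSucc]
  simp [State.orders]

theorem State.sum_tail_orders (x : State τ) (q : ℕ) :
    x.arrival q + ∑ j, Fin.tail (x.orders q) j = ∑ j, x.pipeline j + q := by
  rw [← x.sum_orders q, Fin.sum_univ_succ]
  rfl

theorem State.partialPosition_last (x : State τ) (q : ℕ) :
    x.partialPosition q τ = x.inventoryPosition + q := by
  have h1 : ∑ j ∈ Finset.range (τ + 1),
      (if hj : j < τ + 1 then (x.orders q ⟨j, hj⟩ : ℤ) else 0) = ∑ j, (x.orders q j : ℤ) :=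
    (Finset.sum_range _).trans (Finset.sum_congr rfl fun j _ => dif_pos j.2)
  have h2 := x.sum_orders q
  zify at h2
  rw [State.partialPosition, h1, h2, State.inventoryPosition]
  ring

theorem State.backorder_next_le (x : State τ) (q d : ℕ) (z : ℕ → Bool) :
    (x.next q d z).backorder ≤ x.unmet q d :=
  (Finset.sum_le_card_nsmul (Finset.range (x.unmet q d)) _ 1
    fun ℓ _ => Bool.toNat_le (z ℓ)).trans (by simp)

theorem State.net_next (x : State τ) (q d : ℕ) (z : ℕ → Bool) :
    ((x.next q d z).onHand : ℤ) - (x.next q d z).backorder =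
      x.partialPosition q 0 - d + ((x.unmet q d : ℤ) - (x.next q d z).backorder) := by
  rw [x.partialPosition_zero]
  have h : (x.next q d z).onHand = (x.onHand + x.arrival q) - (x.backorder + d) := rfl
  rw [h, State.unmet]
  omega

theorem State.orders_next (x : State τ) (q d : ℕ) (z : ℕ → Bool) (q' : ℕ) {j : ℕ} (hj : j < τ) :
    (x.next q d z).orders q' ⟨j, by omega⟩ = x.orders q ⟨j + 1, by omega⟩ := by
  have h : (⟨j, by omega⟩ : Fin (τ + 1)) = Fin.castSucc ⟨j, hj⟩ := rfl
  rw [h, State.orders, Fin.snoc_castSucc]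
  rfl

/-- The delivered order moves from the pipeline into net inventory, so the set of orders counted
only shifts its index; for `k < τ` the new order `q'` is not among them. -/
theorem State.partialPosition_next (x : State τ) (q d : ℕ) (z : ℕ → Bool) (q' : ℕ) {k : ℕ}
    (hk : k < τ) :
    (x.next q d z).partialPosition q' k =
      x.partialPosition q (k + 1) - d + ((x.unmet q d : ℤ) - (x.next q d z).backorder) := by
  rw [State.partialPosition, x.net_next, x.partialPosition_zero, State.partialPosition,
    Finset.sum_range_succ' _ (k + 1)]
  have hs : ∑ j ∈ Finset.range (k + 1),
      (if hj : j < τ + 1 then ((x.next q d z).orders q' ⟨j, hj⟩ : ℤ) else 0) =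
      ∑ j ∈ Finset.range (k + 1),
      (if hj : j + 1 < τ + 1 then (x.orders q ⟨j + 1, hj⟩ : ℤ) else 0) := by
    refine Finset.sum_congr rfl fun j hj => ?_
    have hj' : j < τ := by have := Finset.mem_range.1 hj; omega
    rw [dif_pos (by omega), dif_pos (by omega), x.orders_next q d z q' hj']
  have h0 : (if hj : 0 < τ + 1 then (x.orders q ⟨0, hj⟩ : ℤ) else 0) = x.arrival q := by
    rw [dif_pos (Nat.succ_pos τ)]
    rfl
  rw [hs, h0]
  ring

theorem State.inventoryPosition_next (x : State τ) (q d : ℕ) (z : ℕ → Bool) :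
    (x.next q d z).inventoryPosition =
      x.inventoryPosition + q - d + ((x.unmet q d : ℤ) - (x.next q d z).backorder) := by
  have h1 := x.net_next q d z
  have h2 := x.sum_tail_orders q
  have h3 : (x.next q d z).pipeline = Fin.tail (x.orders q) := rfl
  rw [x.partialPosition_zero] at h1
  zify at h2
  rw [State.inventoryPosition, State.inventoryPosition, h3]
  linarith

theorem State.backorder_next_allWait (x : State τ) (q d n : ℕ) :
    (x.next q d (allWait n)).backorder = x.unmet q d := by
  simp [State.next, allWait]

theorem State.size_next_le (x : State τ) (q d : ℕ) (z : ℕ → Bool) :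
    (x.next q d z).size ≤ x.size + q + d := by
  have h1 := x.sum_tail_orders q
  have h2 := x.backorder_next_le q d z
  have h3 : (x.next q d z).onHand = (x.onHand + x.arrival q) - (x.backorder + d) := rfl
  have h4 : (x.next q d z).pipeline = Fin.tail (x.orders q) := rfl
  rw [State.size, State.size, h3, h4]
  rw [State.unmet] at h2
  omega

theorem State.arrival_le (x : State τ) (q : ℕ) : x.arrival q ≤ x.size + q := by
  have h1 := x.sum_tail_orders q
  rw [State.size]
  omega

theorem State.abs_inventoryPosition_le (x : State τ) : |x.inventoryPosition| ≤ x.size := by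
  have h : (∑ j, (x.pipeline j : ℤ)) = ((∑ j, x.pipeline j : ℕ) : ℤ) := by push_cast; rfl
  rw [State.inventoryPosition, State.size, h, abs_le]
  constructor <;> omega

theorem baseStock_le (s : ℤ) (n : ℕ) (x : State τ) : baseStock τ s n x ≤ s.natAbs + x.size := by
  have h := abs_le.1 x.abs_inventoryPosition_le
  rw [baseStock]
  omega

theorem inventoryPosition_add_baseStock (s : ℤ) (n : ℕ) (x : State τ) :
    x.inventoryPosition + baseStock τ s n x = max x.inventoryPosition s := by
  rw [baseStock]
  omega

/-! ### Coupling of the two systems along base-stock paths -/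

/-- Partial positions along the path of the base-stock policy. -/
def pathPosition (s : ℤ) (x : State τ) (d : ℕ → ℕ) (z : ℕ → ℕ → Bool) (n k : ℕ) : ℤ :=
  (path (baseStock τ s) x d z n).partialPosition
    (baseStock τ s n (path (baseStock τ s) x d z n)) k

/-- Unmet demand along the path of the base-stock policy. -/
def pathUnmet (s : ℤ) (x : State τ) (d : ℕ → ℕ) (z : ℕ → ℕ → Bool) (n : ℕ) : ℕ :=
  (path (baseStock τ s) x d z n).unmet (baseStock τ s n (path (baseStock τ s) x d z n)) (d n)

/-- Lost sales along the path of the base-stock policy. -/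
def pathLost (s : ℤ) (x : State τ) (d : ℕ → ℕ) (z : ℕ → ℕ → Bool) (n : ℕ) : ℤ :=
  (pathUnmet s x d z n : ℤ) - (path (baseStock τ s) x d z (n + 1)).backorder

variable (s : ℤ) (x : State τ) (d : ℕ → ℕ) (z : ℕ → ℕ → Bool)

theorem pathLost_nonneg (n : ℕ) : 0 ≤ pathLost s x d z n := by
  have h := (path (baseStock τ s) x d z n).backorder_next_le
    (baseStock τ s n (path (baseStock τ s) x d z n)) (d n) (z n)
  rw [pathLost, sub_nonneg]
  exact_mod_cast h

theorem pathLost_allWait (n : ℕ) : pathLost s x d allWait n = 0 := by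
  rw [pathLost, sub_eq_zero]
  exact_mod_cast ((path (baseStock τ s) x d allWait n).backorder_next_allWait _ _ n).symm

theorem pathPosition_last (n : ℕ) :
    pathPosition s x d z n τ = max (path (baseStock τ s) x d z n).inventoryPosition s := by
  rw [pathPosition, State.partialPosition_last, inventoryPosition_add_baseStock]

theorem inventoryPosition_path_succ (n : ℕ) :
    (path (baseStock τ s) x d z (n + 1)).inventoryPosition =
      pathPosition s x d z n τ - d n + pathLost s x d z n := by
  rw [pathPosition, State.partialPosition_last]
  exact State.inventoryPosition_next _ _ _ _

theorem pathPosition_succ (n : ℕ) {k : ℕ} (hk : k < τ) :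
    pathPosition s x d z (n + 1) k =
      pathPosition s x d z n (k + 1) - d n + pathLost s x d z n :=
  State.partialPosition_next _ _ _ _ _ hk

theorem pathUnmet_eq (n : ℕ) :
    (pathUnmet s x d z n : ℤ) = max (d n - pathPosition s x d z n 0) 0 := by
  rw [pathPosition, State.partialPosition_zero, pathUnmet, State.unmet]
  omega

theorem onHand_path_succ (n : ℕ) :
    ((path (baseStock τ s) x d z (n + 1)).onHand : ℤ) =
      max (pathPosition s x d z n 0 - d n) 0 := by
  rw [pathPosition, State.partialPosition_zero, path, State.next]
  dsimp only
  omega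

/-- The recursion is monotone in the later positions, and lost sales only raise positions. All `k`
are treated at once because `k` at time `n + 1` needs `k + 1` at time `n`. -/
theorem pathPosition_allWait_le (n : ℕ) :
    (∀ k ≤ τ, pathPosition s x d allWait n k ≤ pathPosition s x d z n k) := by
  induction n with
  | zero => exact fun k _ => le_rfl
  | succ n ih =>
    intro k hk
    have h1 := pathLost_allWait s x d n
    have h2 := pathLost_nonneg s x d z n
    rcases hk.lt_or_eq with hk | rfl
    · have h3 := ih (k + 1) hk
      rw [pathPosition_succ s x d _ n hk, pathPosition_succ s x d _ n hk]
      omega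
    -- At `k = τ` the order is refilled, and `max · s` preserves the order of the inventory
    -- positions.
    · have h3 := ih _ le_rfl
      rw [pathPosition_last, pathPosition_last, inventoryPosition_path_succ,
        inventoryPosition_path_succ]
      omega

theorem pathUnmet_le_allWait (n : ℕ) : pathUnmet s x d z n ≤ pathUnmet s x d allWait n := by
  have h := pathPosition_allWait_le s x d z n 0 (Nat.zero_le τ)
  have h1 := pathUnmet_eq s x d z n
  have h2 := pathUnmet_eq s x d allWait n
  omega

theorem backorder_path_le_allWait (n : ℕ) :
    (path (baseStock τ s) x d z n).backorder ≤ (path (baseStock τ s) x d allWait n).backorder := by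
  cases n with
  | zero => exact le_rfl
  | succ n =>
    have h1 := pathLost_allWait s x d n
    have h2 := pathLost_nonneg s x d z n
    have h3 := pathUnmet_le_allWait s x d z n
    rw [pathLost] at h1 h2
    omega

/-- Excess of the partial positions over those of the fully backordered system. -/
def positionExcess (n k : ℕ) : ℤ := pathPosition s x d z n k - pathPosition s x d allWait n k

theorem positionExcess_nonneg (n : ℕ) {k : ℕ} (hk : k ≤ τ) : 0 ≤ positionExcess s x d z n k :=
  sub_nonneg.2 (pathPosition_allWait_le s x d z n k hk)

theorem positionExcess_last_le (n : ℕ) :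
    positionExcess s x d z n τ ≤
      max ((path (baseStock τ s) x d z n).inventoryPosition - s) 0 := by
  rw [positionExcess, pathPosition_last, pathPosition_last]
  omega

/-- This sum is the potential for holding costs: excess enters at index `τ`, leaves at index `0`,
and each lost unit adds one at all `τ` indices. -/
theorem sum_positionExcess_succ (n : ℕ) :
    ∑ k ∈ Finset.range τ, positionExcess s x d z (n + 1) k =
      ∑ k ∈ Finset.range τ, positionExcess s x d z n k - positionExcess s x d z n 0 +
        positionExcess s x d z n τ + τ * pathLost s x d z n := by
  have h : ∀ k ∈ Finset.range τ, positionExcess s x d z (n + 1) k =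
      positionExcess s x d z n (k + 1) + pathLost s x d z n := by
    intro k hk
    rw [positionExcess, positionExcess, pathPosition_succ s x d _ n (Finset.mem_range.1 hk),
      pathPosition_succ s x d _ n (Finset.mem_range.1 hk), pathLost_allWait]
    ring
  have h2 := Finset.sum_range_succ (positionExcess s x d z n) τ
  rw [Finset.sum_range_succ'] at h2
  rw [Finset.sum_congr rfl h, Finset.sum_add_distrib, Finset.sum_const, Finset.card_range,
    nsmul_eq_mul]
  linarith

/-! ### Pathwise profit comparison -/

/-- Realized profit of a period, with backorder cost `b`, as a function of the state. -/
noncomputable def stateProfit (π : Policy τ) (r h b : ℝ) (n : ℕ) (y : State τ) (m : ℕ) : ℝ :=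
  realizedProfit r h y.onHand y.backorder (y.arrival (π n y)) m -
    b * max ((y.backorder : ℝ) + m - y.onHand - y.arrival (π n y)) 0

theorem stateProfit_path (r h b : ℝ) (n : ℕ) :
    stateProfit (baseStock τ s) r h b n (path (baseStock τ s) x d z n) (d n) =
      r * ((path (baseStock τ s) x d z n).backorder + d n - pathUnmet s x d z n) -
        h * (path (baseStock τ s) x d z (n + 1)).onHand - b * pathUnmet s x d z n := by
  have h1 : (pathUnmet s x d z n : ℝ) = ((pathUnmet s x d z n : ℤ) : ℝ) := by push_cast; rfl
  have h2 : ((path (baseStock τ s) x d z (n + 1)).onHand : ℝ) =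
    (((path (baseStock τ s) x d z (n + 1)).onHand : ℤ) : ℝ) := by push_cast; rfl
  rw [h1, h2, pathUnmet_eq, onHand_path_succ, pathPosition, State.partialPosition_zero,
    stateProfit, realizedProfit]
  set y := path (baseStock τ s) x d z n
  set q := y.arrival (baseStock τ s n y)
  push_cast
  -- Sales are total requirements minus unmet demand.
  have h3 : min ((y.onHand : ℝ) + q) (y.backorder + d n) =
      y.backorder + d n - max ((d n : ℝ) - (y.onHand + q - y.backorder)) 0 := by
    rcases le_total ((y.onHand : ℝ) + q) (y.backorder + d n) with h | h
    · rw [min_eq_left h, max_eq_left (by linarith)]; ring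
    · rw [min_eq_right h, max_eq_right (by linarith)]; ring
  rw [h3]
  have h4 : (y.backorder : ℝ) + d n - y.onHand - q = d n - (y.onHand + q - y.backorder) := by ring
  rw [h4]

/-- Pathwise comparison of the two systems, one period at a time. -/
theorem stateProfit_allWait_le {r h : ℝ} (hr : 0 ≤ r) (hh : 0 ≤ h) (n : ℕ) :
    stateProfit (baseStock τ s) r h (r + τ * h) n (path (baseStock τ s) x d allWait n) (d n) -
      h * (max ((path (baseStock τ s) x d z n).inventoryPosition - s) 0 : ℤ) +
      r * ((path (baseStock τ s) x d allWait (n + 1)).backorder -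
        (path (baseStock τ s) x d z (n + 1)).backorder) +
      h * (∑ k ∈ Finset.range τ, positionExcess s x d z (n + 1) k : ℤ) ≤
    stateProfit (baseStock τ s) r h 0 n (path (baseStock τ s) x d z n) (d n) +
      r * ((path (baseStock τ s) x d allWait n).backorder -
        (path (baseStock τ s) x d z n).backorder) +
      h * (∑ k ∈ Finset.range τ, positionExcess s x d z n k : ℤ) := by
  rw [stateProfit_path, stateProfit_path, sum_positionExcess_succ]
  have hU := pathUnmet_le_allWait s x d z n
  have hB : (((path (baseStock τ s) x d allWait (n + 1)).backorder : ℤ) : ℝ) =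
      ((pathUnmet s x d allWait n : ℤ) : ℝ) := by
    have := pathLost_allWait s x d n
    rw [pathLost, sub_eq_zero] at this
    rw [this]
  have hL : (pathLost s x d z n : ℝ) =
      (pathUnmet s x d z n : ℝ) - (path (baseStock τ s) x d z (n + 1)).backorder := by
    rw [pathLost]; push_cast; rfl
  have hLU : (pathLost s x d z n : ℝ) ≤ pathUnmet s x d allWait n := by
    have : pathLost s x d z n ≤ pathUnmet s x d allWait n := by rw [pathLost]; omega
    exact_mod_cast this
  have hI : ((path (baseStock τ s) x d z (n + 1)).onHand : ℝ) -
      (path (baseStock τ s) x d allWait (n + 1)).onHand ≤ positionExcess s x d z n 0 := by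
    have h1 := onHand_path_succ s x d z n
    have h2 := onHand_path_succ s x d allWait n
    have h3 := pathPosition_allWait_le s x d z n 0 (Nat.zero_le τ)
    have : ((path (baseStock τ s) x d z (n + 1)).onHand : ℤ) -
      (path (baseStock τ s) x d allWait (n + 1)).onHand ≤ positionExcess s x d z n 0 := by
      rw [positionExcess]; omega
    exact_mod_cast this
  have hO : (positionExcess s x d z n τ : ℝ) ≤
      (max ((path (baseStock τ s) x d z n).inventoryPosition - s) 0 : ℤ) := by
    exact_mod_cast positionExcess_last_le s x d z n
  have hτ : (0 : ℝ) ≤ τ := Nat.cast_nonneg τ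
  -- A lost unit costs `r` in revenue and up to `τ * h` in holding; this is where the backorder cost
  -- comes from.
  have m1 := mul_le_mul_of_nonneg_left hLU (add_nonneg hr (mul_nonneg hτ hh))
  have m2 := mul_le_mul_of_nonneg_left hI hh
  have m3 := mul_le_mul_of_nonneg_left hO hh
  push_cast at m3 hB ⊢
  rw [hB]
  rw [hL] at m1 ⊢
  linarith

/-- Pathwise comparison of the cumulative profits of the two systems. -/
theorem sum_stateProfit_allWait_le {r h : ℝ} (hr : 0 ≤ r) (hh : 0 ≤ h) (N : ℕ) :
    ∑ n ∈ Finset.range N,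
        stateProfit (baseStock τ s) r h (r + τ * h) n (path (baseStock τ s) x d allWait n) (d n) -
      h * ∑ n ∈ Finset.range N,
        max (((path (baseStock τ s) x d z n).inventoryPosition : ℝ) - s) 0 ≤
    ∑ n ∈ Finset.range N,
        stateProfit (baseStock τ s) r h 0 n (path (baseStock τ s) x d z n) (d n) := by
  -- The potentials must be kept for the induction to close; they are zero at `N = 0` because the
  -- initial states agree, and are discarded by sign afterwards.
  have key : ∑ n ∈ Finset.range N,
        stateProfit (baseStock τ s) r h (r + τ * h) n (path (baseStock τ s) x d allWait n) (d n) -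
      h * ∑ n ∈ Finset.range N,
        max (((path (baseStock τ s) x d z n).inventoryPosition : ℝ) - s) 0 +
      r * ((path (baseStock τ s) x d allWait N).backorder -
        (path (baseStock τ s) x d z N).backorder) +
      h * (∑ k ∈ Finset.range τ, positionExcess s x d z N k : ℤ) ≤
    ∑ n ∈ Finset.range N,
        stateProfit (baseStock τ s) r h 0 n (path (baseStock τ s) x d z n) (d n) := by
    induction N with
    | zero => simp [path, positionExcess, pathPosition]
    | succ N ih =>
      have h1 := stateProfit_allWait_le s x d z hr hh N
      rw [Finset.sum_range_succ, Finset.sum_range_succ, Finset.sum_range_succ, mul_add]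
      push_cast at h1 ih ⊢
      linarith
  have h1 : (0 : ℝ) ≤ r * ((path (baseStock τ s) x d allWait N).backorder -
      (path (baseStock τ s) x d z N).backorder) :=
    mul_nonneg hr (sub_nonneg.2 (by exact_mod_cast backorder_path_le_allWait s x d z N))
  have h2 : (0 : ℝ) ≤ h * (∑ k ∈ Finset.range τ, positionExcess s x d z N k : ℤ) := by
    refine mul_nonneg hh (Int.cast_nonneg (Finset.sum_nonneg fun k hk => ?_))
    exact positionExcess_nonneg s x d z N (Finset.mem_range.1 hk).le
  linarith

end Dynamics

end PartialBackorder

namespace PartialBackorder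

/-! ### Measurability, independence and integrability -/

section Probability

variable {τ : ℕ}

instance : MeasurableSpace (State τ) := ⊤

instance : DiscreteMeasurableSpace (State τ) := ⟨fun _ => trivial⟩

instance : Countable (State τ) :=
  Function.Injective.countable (f := fun y : State τ => (y.onHand, y.backorder, y.pipeline))
    fun y y' h => by
      cases y
      cases y'
      simp only [Prod.mk.injEq] at h
      obtain ⟨rfl, rfl, rfl⟩ := h
      rfl

theorem measurable_next (y : State τ) (q m : ℕ) :
    Measurable fun z : ℕ → Bool => y.next q m z := by
  have h : Measurable fun z : ℕ → Bool =>
      ∑ ℓ ∈ Finset.range (y.unmet q m), (z ℓ).toNat :=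
    Finset.measurable_sum _ fun ℓ _ =>
      (measurable_of_countable Bool.toNat).comp (measurable_pi_apply ℓ)
  exact (measurable_of_countable fun b : ℕ =>
    (⟨(y.onHand + y.arrival q) - (y.backorder + m), b, Fin.tail (y.orders q)⟩ : State τ)).comp h

theorem measurable_path (π : Policy τ) (x : State τ) (n : ℕ) :
    Measurable fun e : (ℕ → ℕ) × (ℕ → ℕ → Bool) => path π x e.1 e.2 n := by
  induction n with
  | zero => exact measurable_const
  | succ n ih =>
    have h : Measurable fun e : (State τ × ℕ) × (ℕ → Bool) =>
        e.1.1.next (π n e.1.1) e.1.2 e.2 :=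
      measurable_from_prod_countable_right fun e => measurable_next e.1 (π n e.1) e.2
    exact h.comp ((ih.prodMk ((measurable_pi_apply n).comp measurable_fst)).prodMk
      ((measurable_pi_apply n).comp measurable_snd))

theorem path_congr (π : Policy τ) (x : State τ) {d d' : ℕ → ℕ} (z : ℕ → ℕ → Bool) {n : ℕ}
    (h : ∀ m < n, d m = d' m) : path π x d z n = path π x d' z n := by
  induction n with
  | zero => rfl
  | succ n ih =>
    rw [path, path, ih fun m hm => h m (hm.trans n.lt_succ_self), h n n.lt_succ_self]

variable {Ω : Type*} [MeasurableSpace Ω] {μ : Measure Ω}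

/-- The joint law factors as a triple product, which is then reassociated. -/
theorem indepFun_prodMk_of_indepFun {α β γ : Type*} [MeasurableSpace α] [MeasurableSpace β]
    [MeasurableSpace γ] [IsProbabilityMeasure μ] {X : Ω → α} {Y : Ω → β} {Z : Ω → γ}
    (hX : Measurable X) (hY : Measurable Y) (hZ : Measurable Z) (hXY : IndepFun X Y μ)
    (hXYZ : IndepFun (fun ω => (X ω, Y ω)) Z μ) : IndepFun X (fun ω => (Y ω, Z ω)) μ := by
  have hYZ : IndepFun Y Z μ := hXYZ.comp measurable_snd measurable_id
  have := Measure.isProbabilityMeasure_map (μ := μ) hX.aemeasurable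
  have := Measure.isProbabilityMeasure_map (μ := μ) hY.aemeasurable
  have := Measure.isProbabilityMeasure_map (μ := μ) hZ.aemeasurable
  rw [indepFun_iff_map_prod_eq_prod_map_map hX.aemeasurable (hY.prodMk hZ).aemeasurable,
    hYZ.map_prod_eq_prod_map_map hY.aemeasurable hZ.aemeasurable,
    ← Measure.prodAssoc_prod, ← hXY.map_prod_eq_prod_map_map hX.aemeasurable hY.aemeasurable,
    ← hXYZ.map_prod_eq_prod_map_map (hX.prodMk hY).aemeasurable hZ.aemeasurable,
    Measure.map_map MeasurableEquiv.prodAssoc.measurable ((hX.prodMk hY).prodMk hZ)]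
  rfl

/-- Integrating out an independent variable. -/
theorem integral_integral_of_indepFun {α β : Type*} [MeasurableSpace α] [MeasurableSpace β]
    [IsProbabilityMeasure μ] {X : Ω → α} {Y : Ω → β} (hX : Measurable X) (hY : Measurable Y)
    (hXY : IndepFun X Y μ) {f : α × β → ℝ} (hf : Measurable f)
    (hi : Integrable (fun ω => f (X ω, Y ω)) μ) :
    Integrable (fun ω => ∫ ω', f (X ω, Y ω') ∂μ) μ ∧
      ∫ ω, ∫ ω', f (X ω, Y ω') ∂μ ∂μ = ∫ ω, f (X ω, Y ω) ∂μ := by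
  have := Measure.isProbabilityMeasure_map (μ := μ) hX.aemeasurable
  have := Measure.isProbabilityMeasure_map (μ := μ) hY.aemeasurable
  have hmap := hXY.map_prod_eq_prod_map_map hX.aemeasurable hY.aemeasurable
  have hprod : Integrable f ((μ.map X).prod (μ.map Y)) := by
    rw [← hmap]
    exact (integrable_map_measure hf.aestronglyMeasurable (hX.prodMk hY).aemeasurable).2 hi
  have hinner : ∀ a, ∫ ω', f (a, Y ω') ∂μ = ∫ b, f (a, b) ∂(μ.map Y) := fun a =>
    (integral_map hY.aemeasurable
      (hf.comp measurable_prodMk_left).aestronglyMeasurable).symm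
  have hl := hprod.integral_prod_left
  simp only [hinner]
  refine ⟨hl.comp_measurable hX, ?_⟩
  rw [← integral_map (f := fun a => ∫ b, f (a, b) ∂(μ.map Y)) hX.aemeasurable
    hl.aestronglyMeasurable, ← integral_prod f hprod, ← hmap,
    integral_map (hX.prodMk hY).aemeasurable hf.aestronglyMeasurable]

variable {D : ℕ → Ω → ℕ} {ξ : ℕ → ℕ → Ω → Bool}

theorem measurable_stateP (hD : ∀ i, Measurable (D i)) (hξ : ∀ i ℓ, Measurable (ξ i ℓ))
    (π : Policy τ) (x : State τ) (i : ℕ) : Measurable (stateP D ξ π x i) :=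
  (measurable_path π x i).comp ((measurable_pi_lambda _ hD).prodMk
    (measurable_pi_lambda _ fun i => measurable_pi_lambda _ (hξ i)))

theorem indepFun_stateP_demand [IsProbabilityMeasure μ] (hD : ∀ i, Measurable (D i))
    (hξ : ∀ i ℓ, Measurable (ξ i ℓ)) (hDi : iIndepFun D μ)
    (hDξ : IndepFun (fun ω => (fun i => D i ω : ℕ → ℕ))
      (fun ω => (fun i ℓ => ξ i ℓ ω : ℕ → ℕ → Bool)) μ)
    (π : Policy τ) (x : State τ) (i : ℕ) : IndepFun (stateP D ξ π x i) (D i) μ := by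
  set W : Ω → (Finset.range i → ℕ) := fun ω j => D j ω with hWdef
  have hW : Measurable W := measurable_pi_lambda _ fun j => hD j
  have hΞ : Measurable fun ω => (fun i ℓ => ξ i ℓ ω : ℕ → ℕ → Bool) :=
    measurable_pi_lambda _ fun i => measurable_pi_lambda _ (hξ i)
  have hDW : IndepFun (D i) W μ := by
    have h := hDi.indepFun_finset {i} (Finset.range i) (by simp) hD
    exact h.comp (φ := fun v : ({i} : Finset ℕ) → ℕ => v ⟨i, Finset.mem_singleton_self i⟩)
      (measurable_pi_apply _) measurable_id
  have hDWξ : IndepFun (fun ω => (D i ω, W ω)) (fun ω => (fun i ℓ => ξ i ℓ ω : ℕ → ℕ → Bool)) μ :=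
    hDξ.comp (φ := fun v : ℕ → ℕ => (v i, fun j : Finset.range i => v j))
      ((measurable_pi_apply i).prodMk (measurable_pi_lambda _ fun j => measurable_pi_apply _))
      measurable_id
  have h := indepFun_prodMk_of_indepFun (hD i) hW hΞ hDW hDWξ
  -- The path map expects an infinite demand sequence; the value `0` from index `i` on is harmless
  -- by `path_congr`.
  have hext : Measurable fun v : Finset.range i → ℕ =>
      (fun j => if hj : j ∈ Finset.range i then v ⟨j, hj⟩ else 0 : ℕ → ℕ) := by
    refine measurable_pi_lambda _ fun j => ?_
    by_cases hj : j ∈ Finset.range i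
    · simpa only [dif_pos hj] using measurable_pi_apply _
    · simpa only [dif_neg hj] using measurable_const
  have h2 := h.symm.comp
    ((measurable_path π x i).comp ((hext.comp measurable_fst).prodMk measurable_snd))
    measurable_id
  have hstate : stateP D ξ π x i = (fun e => path π x e.1 e.2 i) ∘ (fun a =>
      (((fun (v : Finset.range i → ℕ) j => if hj : j ∈ Finset.range i then v ⟨j, hj⟩ else 0) ∘
        Prod.fst) a, a.2)) ∘ fun ω => (W ω, fun i ℓ => ξ i ℓ ω) := by
    funext ω
    refine path_congr π x _ fun m hm => ?_
    simp [hWdef, hm]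
  rw [hstate]
  exact h2

/-- A base-stock order is at most `|s|` plus the size, so in one period the size at most doubles, up
to `|s|` and the demand. -/
theorem integrable_size_stateP [IsFiniteMeasure μ] (hD : ∀ i, Measurable (D i))
    (hξ : ∀ i ℓ, Measurable (ξ i ℓ)) (hDint : ∀ i, Integrable (fun ω => (D i ω : ℝ)) μ)
    (s : ℤ) (x : State τ) (i : ℕ) :
    Integrable (fun ω => ((stateP D ξ (baseStock τ s) x i ω).size : ℝ)) μ := by
  induction i with
  | zero => exact integrable_const (μ := μ) (x.size : ℝ)
  | succ i ih =>
    refine Integrable.mono' (((ih.const_mul 2).add (integrable_const (s.natAbs : ℝ))).add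
      (hDint i)) ((measurable_of_countable fun y : State τ => (y.size : ℝ)).comp
        (measurable_stateP hD hξ _ x (i + 1))).aestronglyMeasurable
      (Eventually.of_forall fun ω => ?_)
    set y := stateP D ξ (baseStock τ s) x i ω with hy
    have h1 := y.size_next_le (baseStock τ s i y) (D i ω) (fun ℓ => ξ i ℓ ω)
    have h2 := baseStock_le s i y
    have h3 : stateP D ξ (baseStock τ s) x (i + 1) ω =
      y.next (baseStock τ s i y) (D i ω) (fun ℓ => ξ i ℓ ω) := rfl
    have h4 : (stateP D ξ (baseStock τ s) x (i + 1) ω).size ≤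
        2 * y.size + s.natAbs + D i ω := by
      rw [h3]
      omega
    rw [Real.norm_of_nonneg (Nat.cast_nonneg _)]
    simp only [Pi.add_apply]
    exact_mod_cast h4

theorem integrable_of_le_size [IsFiniteMeasure μ] (hD : ∀ i, Measurable (D i))
    (hξ : ∀ i ℓ, Measurable (ξ i ℓ)) (hDint : ∀ i, Integrable (fun ω => (D i ω : ℝ)) μ)
    (s : ℤ) (x : State τ) (i : ℕ) (g : State τ → ℝ) (c : ℝ) (hg : ∀ y, |g y| ≤ 2 * y.size + c) :
    Integrable (fun ω => g (stateP D ξ (baseStock τ s) x i ω)) μ :=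
  (((integrable_size_stateP hD hξ hDint s x i).const_mul 2).add (integrable_const c)).mono'
    ((measurable_of_countable g).comp (measurable_stateP hD hξ _ x i)).aestronglyMeasurable
    (Eventually.of_forall fun _ => hg _)

theorem integrable_stateProfit [IsFiniteMeasure μ] (hD : ∀ i, Measurable (D i))
    (hξ : ∀ i ℓ, Measurable (ξ i ℓ)) (hDint : ∀ i, Integrable (fun ω => (D i ω : ℝ)) μ)
    (s : ℤ) (x : State τ) (r h b : ℝ) (i : ℕ) :
    Integrable (fun ω => stateProfit (baseStock τ s) r h b i
      (stateP D ξ (baseStock τ s) x i ω) (D i ω)) μ := by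
  have hI := integrable_of_le_size hD hξ hDint s x i (fun y => (y.onHand : ℝ)) 0 fun y => by
    have : y.onHand ≤ 2 * y.size + 0 := by rw [State.size]; omega
    rw [abs_of_nonneg (Nat.cast_nonneg _)]
    exact_mod_cast this
  have hB := integrable_of_le_size hD hξ hDint s x i (fun y => (y.backorder : ℝ)) 0 fun y => by
    have : y.backorder ≤ 2 * y.size + 0 := by rw [State.size]; omega
    rw [abs_of_nonneg (Nat.cast_nonneg _)]
    exact_mod_cast this
  have hQ := integrable_of_le_size hD hξ hDint s x i
    (fun y => (y.arrival (baseStock τ s i y) : ℝ)) s.natAbs fun y => by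
    have h1 := baseStock_le s i y
    have h2 := y.arrival_le (baseStock τ s i y)
    have : y.arrival (baseStock τ s i y) ≤ 2 * y.size + s.natAbs := by omega
    rw [abs_of_nonneg (Nat.cast_nonneg _)]
    exact_mod_cast this
  exact ((((hI.add hQ).inf (hB.add (hDint i))).const_mul r).sub
    (((((hI.add hQ).sub hB).sub (hDint i)).sup (integrable_const 0)).const_mul h)).sub
    (((((hB.add (hDint i)).sub hI).sub hQ).sup (integrable_const 0)).const_mul b)

theorem integrable_overshoot [IsFiniteMeasure μ] (hD : ∀ i, Measurable (D i))
    (hξ : ∀ i ℓ, Measurable (ξ i ℓ)) (hDint : ∀ i, Integrable (fun ω => (D i ω : ℝ)) μ)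
    (s : ℤ) (x : State τ) (i : ℕ) : Integrable (overshoot D ξ s x i) μ := by
  have hP := integrable_of_le_size hD hξ hDint s x i
    (fun y => (y.inventoryPosition : ℝ)) 0 fun y => by
    have h1 := y.abs_inventoryPosition_le
    have : |y.inventoryPosition| ≤ 2 * (y.size : ℤ) + 0 := by omega
    exact_mod_cast this
  exact (hP.sub (integrable_const (s : ℝ))).sup (integrable_const 0)

theorem integral_expectedProfitBackorder [IsProbabilityMeasure μ] (hD : ∀ i, Measurable (D i))
    (hξ : ∀ i ℓ, Measurable (ξ i ℓ)) (hDint : ∀ i, Integrable (fun ω => (D i ω : ℝ)) μ)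
    (hDi : iIndepFun D μ) (hDξ : IndepFun (fun ω => (fun i => D i ω : ℕ → ℕ))
      (fun ω => (fun i ℓ => ξ i ℓ ω : ℕ → ℕ → Bool)) μ)
    (s : ℤ) (x : State τ) (r h b : ℝ) (i : ℕ) :
    Integrable (fun ω => ∫ ω', stateProfit (baseStock τ s) r h b i
      (stateP D ξ (baseStock τ s) x i ω) (D i ω') ∂μ) μ ∧
    ∫ ω, ∫ ω', stateProfit (baseStock τ s) r h b i
      (stateP D ξ (baseStock τ s) x i ω) (D i ω') ∂μ ∂μ =
    ∫ ω, stateProfit (baseStock τ s) r h b i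
      (stateP D ξ (baseStock τ s) x i ω) (D i ω) ∂μ :=
  integral_integral_of_indepFun (f := fun e : State τ × ℕ =>
      stateProfit (baseStock τ s) r h b i e.1 e.2) (measurable_stateP hD hξ _ x i) (hD i)
    (indepFun_stateP_demand hD hξ hDi hDξ _ x i) (measurable_of_countable _)
    (integrable_stateProfit hD hξ hDint s x r h b i)

theorem profitP_eq (π : Policy τ) (r h : ℝ) (x : State τ) (i : ℕ) :
    profitP μ D ξ π r h x i =
      fun ω => ∫ ω', stateProfit π r h 0 i (stateP D ξ π x i ω) (D i ω') ∂μ := by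
  funext ω
  simp [profitP, expectedProfit, stateProfit]

/-- Negation turns the limsup into a liminf, and liminf is superadditive in `EReal`, where `⊥ + ⊤ =
⊥`. -/
theorem liminf_sub_limsup_le {u v w : ℕ → ℝ} (h : ∀ n, v n - w n ≤ u n) :
    liminf (fun n => (v n : EReal)) atTop - limsup (fun n => (w n : EReal)) atTop ≤
      liminf (fun n => (u n : EReal)) atTop := by
  rw [sub_eq_add_neg, ← EReal.liminf_neg]
  refine EReal.le_liminf_add.trans (liminf_le_liminf (Eventually.of_forall fun n => ?_))
  simpa [sub_eq_add_neg] using EReal.coe_le_coe_iff.2 (h n)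

end Probability

end PartialBackorder

theorem mainTheorem10 {Ω : Type*} [MeasurableSpace Ω] (μ : Measure Ω) [IsProbabilityMeasure μ]
    (τ : ℕ) (p r h : ℝ) (hp₀ : 0 ≤ p) (hp₁ : p ≤ 1) (hr : 0 ≤ r) (hh : 0 ≤ h)
    (D : ℕ → Ω → ℕ) (ξ : ℕ → ℕ → Ω → Bool) (hM : PartialBackorder.IsModel μ p D ξ)
    (s : ℤ) (x : PartialBackorder.State τ) (hx : x ∈ PartialBackorder.stateSpace τ) :
    (∀ i, Integrable
        (PartialBackorder.profitP μ D ξ (PartialBackorder.baseStock τ s) r h x i) μ) ∧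
    (∀ i, Integrable
        (PartialBackorder.profitB μ D (PartialBackorder.baseStock τ s) r h (r + τ * h) x i) μ) ∧
    (∀ i, Integrable (PartialBackorder.overshoot D ξ s x i) μ) ∧
    PartialBackorder.avgProfitP μ D ξ (PartialBackorder.baseStock τ s) r h x ≥
      PartialBackorder.avgProfitB μ D (PartialBackorder.baseStock τ s) r h (r + τ * h) x -
        PartialBackorder.avgOvershootCost μ D ξ s h x := by
  open PartialBackorder in
  have hD := hM.demand_measurable
  have hξ := hM.patience_measurable
  have hDint : ∀ i, Integrable (fun ω => (D i ω : ℝ)) μ := fun i =>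
    ((hM.demand_identDistrib i).comp (measurable_of_countable (Nat.cast : ℕ → ℝ))).integrable_iff.2
      hM.demand_integrable
  have hwait : ∀ i ℓ : ℕ, Measurable fun _ : Ω => allWait i ℓ := fun _ _ => measurable_const
  have hP := integral_expectedProfitBackorder hD hξ hDint hM.demand_indep
    hM.demand_indep_patience s x r h 0
  -- The B-system is the P-system with constant decisions, which are independent of everything, so
  -- the same lemmas apply.
  have hB := integral_expectedProfitBackorder (ξ := fun i ℓ _ => allWait i ℓ) hD hwait hDint
    hM.demand_indep (indepFun_const_right _ allWait) s x r h (r + τ * h)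
  have hPr := integrable_stateProfit hD hξ hDint s x r h 0
  have hBr := integrable_stateProfit (ξ := fun i ℓ _ => allWait i ℓ) hD hwait hDint s x r h
    (r + τ * h)
  have hO := integrable_overshoot hD hξ hDint s x
  have hPi : ∀ i, Integrable (profitP μ D ξ (baseStock τ s) r h x i) μ := fun i => by
    rw [profitP_eq]
    exact (hP i).1
  have hBi : ∀ i, Integrable (profitB μ D (baseStock τ s) r h (r + τ * h) x i) μ :=
    fun i => (hB i).1
  refine ⟨hPi, hBi, hO, liminf_sub_limsup_le fun N => ?_⟩
  rw [← mul_sub]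
  refine mul_le_mul_of_nonneg_left ?_ (by positivity)
  have hPint : ∀ i, ∫ ω, profitP μ D ξ (baseStock τ s) r h x i ω ∂μ = _ := fun i =>
    (congrArg (fun f => ∫ ω, f ω ∂μ) (profitP_eq (baseStock τ s) r h x i)).trans (hP i).2
  have hBint : ∀ i, ∫ ω, profitB μ D (baseStock τ s) r h (r + τ * h) x i ω ∂μ = _ :=
    fun i => (hB i).2
  rw [integral_finsetSum _ fun i _ => hPi i, integral_finsetSum _ fun i _ => hBi i,
    Finset.sum_congr rfl fun i _ => hPint i, Finset.sum_congr rfl fun i _ => hBint i,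
    ← integral_finsetSum _ fun i _ => hPr i, ← integral_finsetSum _ fun i _ => hBr i,
    ← integral_const_mul, ← integral_sub (integrable_finsetSum _ fun i _ => hBr i)
      ((integrable_finsetSum _ fun i _ => hO i).const_mul h)]
  refine integral_mono ((integrable_finsetSum _ fun i _ => hBr i).sub
    ((integrable_finsetSum _ fun i _ => hO i).const_mul h))
    (integrable_finsetSum _ fun i _ => hPr i) fun ω => ?_
  exact sum_stateProfit_allWait_le s x (fun n => D n ω) (fun n ℓ => ξ n ℓ ω) hr hh N
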